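/- A pseudo-BCK algebra is a structure $(A,\le,\to,\rightsquigarrow,1)$ with a binary relation $\le$, binary operations $\to,\rightsquigarrow$ and an element $1$ such that for all $x,y,z\in A$: $x\to y\le (y\to z)\rightsquigarrow(x\to z)$ and $x\rightsquigarrow y\le (y\rightsquigarrow z)\to(x\rightsquigarrow z)$; $x\le (x\to y)\rightsquigarrow y$ and $x\le (x\rightsquigarrow y)\to y$; $x\le x$; $x\le 1$; $x\le y$ and $y\le x$ imply $x=y$; and $x\le y$ iff $x\to y=1$ iff $x\rightsquigarrow y=1$. It is bounded if it has an element $0$ with $0\le x$ for all $x\in A$. Let $A$ be a bounded pseudo-BCK algebra. A Bosbach state on $A$ is a function $s:A\to[0,1]$ with $s(0)=0$, $s(1)=1$, $s(x)+s(x\to y)=s(y)+s(y\to x)$ and $s(x)+s(x\rightsquigarrow y)=s(y)+s(y\rightsquigarrow x)$ for all $x,y\in A$. A state-morphism on $A$ is a function $m:A\to[0,1]$ with $m(0)=0$ and $m(x\to y)=m(x\rightsquigarrow y)=\min\{1-m(x)+m(y),1\}$ for all $x,y\in A$. Let $\mathcal W\subseteq[0,1]^A$ be the set of all state-morphisms on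 $A$, with the topology of pointwise convergence (the subspace topology of the product topology), in which it is a compact Hausdorff space, and let $\mathcal B(\mathcal W)$ be its Borel $\sigma$-algebra, generated by the open subsets of $\mathcal W$. Theorem. For every Bosbach state $s$ on $A$ there is a ($\sigma$-additive) regular Borel probability measure $\mu$ on $\mathcal B(\mathcal W)$ such that $$s(a)=\int_{\mathcal W}V(a)\,d\mu(V)\qquad\text{for all }a\in A.$$ In particular, every Bosbach state on $A$ is a Borel state. -/

import Mathlib

open MeasureTheory

/-- A pseudo-BCK algebra `(A, ≤, →, ⇝, 1)`; `arr x y` is `x → y` and `sarr x y` is `x ⇝ y`. -/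
class PseudoBCKAlgebra (A : Type*) extends LE A, One A where
  /-- the implication `→` -/
  arr : A → A → A
  /-- the implication `⇝` -/
  sarr : A → A → A
  arr_le_sarr : ∀ x y z : A, arr x y ≤ sarr (arr y z) (arr x z)
  sarr_le_arr : ∀ x y z : A, sarr x y ≤ arr (sarr y z) (sarr x z)
  le_sarr_arr : ∀ x y : A, x ≤ sarr (arr x y) y
  le_arr_sarr : ∀ x y : A, x ≤ arr (sarr x y) y
  le_refl : ∀ x : A, x ≤ x
  le_one : ∀ x : A, x ≤ 1
  le_antisymm : ∀ x y : A, x ≤ y → y ≤ x → x = y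
  le_iff_arr : ∀ x y : A, x ≤ y ↔ arr x y = 1
  le_iff_sarr : ∀ x y : A, x ≤ y ↔ sarr x y = 1

/-- A bounded pseudo-BCK algebra: a pseudo-BCK algebra with a least element `0`. -/
class BoundedPseudoBCKAlgebra (A : Type*) extends PseudoBCKAlgebra A, Zero A where
  zero_le : ∀ x : A, 0 ≤ x

namespace PseudoBCKAlgebra

/-- Bosbach states `s : A → [0,1]` on a bounded pseudo-BCK algebra. -/
structure IsBosbachState {A : Type*} [BoundedPseudoBCKAlgebra A] (s : A → unitInterval) :
    Prop where
  add_arr : ∀ x y : A, (s x : ℝ) + s (arr x y) = s y + s (arr y x)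
  add_sarr : ∀ x y : A, (s x : ℝ) + s (sarr x y) = s y + s (sarr y x)
  map_zero : s 0 = 0
  map_one : s 1 = 1

/-- State-morphisms `m : A → [0,1]` on a bounded pseudo-BCK algebra: `m 0 = 0`, and both
implications are sent to the Łukasiewicz implication `min {1 - x + y, 1}` of `[0,1]`. -/
structure IsStateMorphism {A : Type*} [BoundedPseudoBCKAlgebra A] (m : A → unitInterval) :
    Prop where
  map_zero : m 0 = 0
  map_arr : ∀ x y : A, (m (arr x y) : ℝ) = min (1 - (m x : ℝ) + m y) 1
  map_sarr : ∀ x y : A, (m (sarr x y) : ℝ) = min (1 - (m x : ℝ) + m y) 1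

/-- The space of all state-morphisms on `A`. -/
def StateMorphism (A : Type*) [BoundedPseudoBCKAlgebra A] : Type _ :=
  {m : A → unitInterval // IsStateMorphism m}

namespace StateMorphism

variable {A : Type*} [BoundedPseudoBCKAlgebra A]

instance : CoeFun (StateMorphism A) (fun _ => A → unitInterval) := ⟨Subtype.val⟩

/-- The weak topology (pointwise convergence): the topology induced by the product topology
on `[0,1]^A`. -/
instance : TopologicalSpace (StateMorphism A) :=
  inferInstanceAs (TopologicalSpace {m : A → unitInterval // IsStateMorphism m})

/-- The Borel `σ`-algebra, generated by all open sets of the weak topology. -/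
instance : MeasurableSpace (StateMorphism A) := borel (StateMorphism A)

instance : BorelSpace (StateMorphism A) := ⟨rfl⟩

instance : T2Space (StateMorphism A) :=
  inferInstanceAs (T2Space {m : A → unitInterval // IsStateMorphism m})

/-- The evaluation `V ↦ V a` is continuous. -/
theorem continuous_eval (a : A) : Continuous fun V : StateMorphism A => (V a : ℝ) :=
  continuous_subtype_val.comp ((continuous_apply a).comp continuous_subtype_val)

/-- The space of state-morphisms is compact. -/
instance : CompactSpace (StateMorphism A) := by
  have hc : ∀ a : A, Continuous fun m : A → unitInterval => (m a : ℝ) := fun a =>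
    continuous_subtype_val.comp (continuous_apply a)
  have h : IsClosed {m : A → unitInterval | IsStateMorphism m} := by
    have e : {m : A → unitInterval | IsStateMorphism m} =
        {m | m 0 = 0} ∩
          ((⋂ x : A, ⋂ y : A, {m | (m (arr x y) : ℝ) = min (1 - (m x : ℝ) + m y) 1}) ∩
            ⋂ x : A, ⋂ y : A, {m | (m (sarr x y) : ℝ) = min (1 - (m x : ℝ) + m y) 1}) := by
      ext m
      simp only [Set.mem_ofPred_eq, Set.mem_inter_iff, Set.mem_iInter]
      exact ⟨fun h => ⟨h.1, h.2, h.3⟩, fun h => ⟨h.1, h.2.1, h.2.2⟩⟩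
    rw [e]
    refine (isClosed_eq (continuous_apply 0) continuous_const).inter
      ((isClosed_iInter fun x => isClosed_iInter fun y => isClosed_eq (hc _) ?_).inter
        (isClosed_iInter fun x => isClosed_iInter fun y => isClosed_eq (hc _) ?_))
    all_goals exact ((continuous_const.sub (hc x)).add (hc y)).min continuous_const
  exact isCompact_iff_compactSpace.mp h.isCompact

end StateMorphism

end PseudoBCKAlgebra

/-! Bosbach states form a compact convex set, so by Krein–Milman and Riesz–Markov it is enough that
extreme states are state-morphisms.

Modulo a state `s`, the element `(x ⇒ y) ⇝ y` acts as a join of `x` and `y`, and the two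
implications have equal values (`arr_eq_sarr`). Fix `x` and let `t r` be the limit of `s` along `x ⇒
⋯ ⇒ x ⇒ r`. Then `t ≥ s` again satisfies the Bosbach identities, so `1 - s = (1 - t) + (t - s)`
splits the defect of `s` into two of the same kind. If `s` is extreme, this forces `1 - t = c * (1 -
s)`. For `x = a ⇒ b` one has `t x = 1`, while prelinearity modulo `s` gives `t (b ⇒ a) = s (b ⇒ a)`.
Hence `s (a ⇒ b) = 1` or `s (b ⇒ a) = 1`, which yields the Łukasiewicz formula. -/

namespace PseudoBCKAlgebra

open Filter Topology

local infixr:60 " ⇒ " => PseudoBCKAlgebra.arr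
local infixr:60 " ⇝ " => PseudoBCKAlgebra.sarr

/-! ### Arithmetic of the two implications. -/

section Order

variable {A : Type*} [PseudoBCKAlgebra A]

/-- The pseudo-BCK algebra with its two implications interchanged. -/
abbrev swap (H : PseudoBCKAlgebra A) : PseudoBCKAlgebra A where
  le := H.le
  one := H.one
  arr := H.sarr
  sarr := H.arr
  arr_le_sarr := H.sarr_le_arr
  sarr_le_arr := H.arr_le_sarr
  le_sarr_arr := H.le_arr_sarr
  le_arr_sarr := H.le_sarr_arr
  le_refl := H.le_refl
  le_one := H.le_one
  le_antisymm := H.le_antisymm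
  le_iff_arr := H.le_iff_sarr
  le_iff_sarr := H.le_iff_arr

theorem eq_one_of_one_le {x : A} (h : 1 ≤ x) : x = 1 :=
  le_antisymm _ _ (le_one x) h

theorem arr_self (x : A) : x ⇒ x = 1 := (le_iff_arr _ _).1 (le_refl x)

theorem arr_one (x : A) : x ⇒ 1 = 1 := (le_iff_arr _ _).1 (le_one x)

theorem one_arr (x : A) : 1 ⇒ x = x := by
  refine le_antisymm _ _ ?_ ?_
  · exact (le_iff_sarr _ _).2 (eq_one_of_one_le (le_sarr_arr 1 x))
  · have h := le_arr_sarr x x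
    rwa [(le_iff_sarr _ _).1 (le_refl x)] at h

theorem one_sarr (x : A) : 1 ⇝ x = x := @one_arr A (swap ‹_›) x

theorem le_trans {x y z : A} (h₁ : x ≤ y) (h₂ : y ≤ z) : x ≤ z := by
  have h := arr_le_sarr x y z
  rw [(le_iff_arr _ _).1 h₁, (le_iff_arr _ _).1 h₂, one_sarr] at h
  exact (le_iff_arr _ _).2 (eq_one_of_one_le h)

theorem arr_anti {x y : A} (h : x ≤ y) (z : A) : y ⇒ z ≤ x ⇒ z := by
  have h' := arr_le_sarr x y z
  rw [(le_iff_arr _ _).1 h] at h'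
  exact (le_iff_sarr _ _).2 (eq_one_of_one_le h')

theorem sarr_anti {x y : A} (h : x ≤ y) (z : A) : y ⇝ z ≤ x ⇝ z :=
  @arr_anti A (swap ‹_›) x y h z

theorem le_sarr_of_le_arr {x y z : A} (h : x ≤ y ⇒ z) : y ≤ x ⇝ z :=
  le_trans (le_sarr_arr y z) (sarr_anti h z)

theorem le_arr_of_le_sarr {x y z : A} (h : x ≤ y ⇝ z) : y ≤ x ⇒ z :=
  @le_sarr_of_le_arr A (swap ‹_›) x y z h

theorem arr_sarr_le (x y z : A) : x ⇒ (y ⇝ z) ≤ y ⇝ (x ⇒ z) :=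
  le_trans (arr_le_sarr x (y ⇝ z) z) (sarr_anti (le_arr_sarr y z) _)

theorem arr_sarr_comm (x y z : A) : x ⇒ (y ⇝ z) = y ⇝ (x ⇒ z) :=
  le_antisymm _ _ (arr_sarr_le x y z) (@arr_sarr_le A (swap ‹_›) y x z)

theorem arr_le_arr_arr (x y z : A) : x ⇒ y ≤ (z ⇒ x) ⇒ (z ⇒ y) :=
  le_arr_of_le_sarr (arr_le_sarr z x y)

theorem arr_mono (z : A) {x y : A} (h : x ≤ y) : z ⇒ x ≤ z ⇒ y := by
  have h' := arr_le_arr_arr x y z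
  rw [(le_iff_arr _ _).1 h] at h'
  exact (le_iff_arr _ _).2 (eq_one_of_one_le h')

theorem le_arr (x y : A) : y ≤ x ⇒ y := by
  refine le_arr_of_le_sarr ?_
  rw [(le_iff_sarr _ _).1 (le_refl y)]
  exact le_one x

theorem le_sarr (x y : A) : y ≤ x ⇝ y := @le_arr A (swap ‹_›) x y

theorem arr_sarr_arr (x y : A) : ((x ⇒ y) ⇝ y) ⇒ y = x ⇒ y :=
  le_antisymm _ _ (arr_anti (le_sarr_arr x y) y) (le_arr_sarr (x ⇒ y) y)

/-- The iterated implication `x → (x → ⋯ → (x → r))`. -/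
def iterArr (x : A) (n : ℕ) (r : A) : A := (arr x)^[n] r

theorem iterArr_succ (x : A) (n : ℕ) (r : A) : iterArr x (n + 1) r = x ⇒ iterArr x n r :=
  Function.iterate_succ_apply' _ _ _

theorem iterArr_add (x : A) (m n : ℕ) (r : A) :
    iterArr x (m + n) r = iterArr x m (iterArr x n r) :=
  Function.iterate_add_apply _ _ _ _

theorem iterArr_one (x : A) (n : ℕ) : iterArr x n 1 = 1 := by
  induction n with
  | zero => rfl
  | succ n ih => rw [iterArr_succ, ih, arr_one]

theorem iterArr_mono (x : A) (n : ℕ) {u v : A} (h : u ≤ v) : iterArr x n u ≤ iterArr x n v := by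
  induction n with
  | zero => exact h
  | succ n ih => rw [iterArr_succ, iterArr_succ]; exact arr_mono x ih

theorem le_iterArr (x : A) (n : ℕ) (r : A) : r ≤ iterArr x n r := by
  induction n with
  | zero => exact le_refl r
  | succ n ih => rw [iterArr_succ]; exact le_trans ih (le_arr _ _)

theorem sarr_iterArr (x : A) (n : ℕ) (p r : A) :
    p ⇝ iterArr x n r = iterArr x n (p ⇝ r) := by
  induction n with
  | zero => rfl
  | succ n ih => rw [iterArr_succ, iterArr_succ, ← ih, arr_sarr_comm]

end Order

/-! ### Joins and iterated implications modulo a state. -/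

/-- Real-valued Bosbach states, where the value at `0` is not normalized. -/
structure IsPreBosbach {A : Type*} [PseudoBCKAlgebra A] (s : A → ℝ) : Prop where
  add_arr : ∀ x y : A, s x + s (x ⇒ y) = s y + s (y ⇒ x)
  add_sarr : ∀ x y : A, s x + s (x ⇝ y) = s y + s (y ⇝ x)
  map_one : s 1 = 1
  nonneg : ∀ x, 0 ≤ s x
  le_one : ∀ x, s x ≤ 1

namespace IsPreBosbach

variable {A : Type*} [H : PseudoBCKAlgebra A] {s : A → ℝ}

theorem swap (h : IsPreBosbach s) : @IsPreBosbach A (swap H) s :=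
  @IsPreBosbach.mk A (PseudoBCKAlgebra.swap H) s h.add_sarr h.add_arr h.map_one h.nonneg h.le_one

theorem arr_of_le (h : IsPreBosbach s) {x y : A} (hyx : y ≤ x) :
    s (x ⇒ y) = 1 - s x + s y := by
  have := h.add_arr x y
  rw [(le_iff_arr _ _).1 hyx, h.map_one] at this
  linarith

theorem mono (h : IsPreBosbach s) {x y : A} (hxy : x ≤ y) : s x ≤ s y := by
  have := h.arr_of_le hxy
  linarith [h.le_one (y ⇒ x)]

theorem sup_eq (h : IsPreBosbach s) (x y : A) :
    s ((x ⇒ y) ⇝ y) = 1 + s y - s (x ⇒ y) := by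
  have := h.arr_of_le (le_sarr (x ⇒ y) y)
  rw [arr_sarr_arr] at this
  linarith

theorem sup_le (h : IsPreBosbach s) {x y u : A} (hx : x ≤ u) (hy : y ≤ u) :
    s ((x ⇒ y) ⇝ y) ≤ s u := by
  have h₁ := h.mono (sarr_anti (arr_anti hx y) y)
  rw [h.sup_eq u y, h.arr_of_le hy] at h₁
  linarith

/-- Both `(x ⇒ y) ⇝ y` and `(x ⇝ y) ⇒ y` are upper bounds of `x` and `y`, so `sup_le` and its mirror
image compare their values. -/
theorem arr_le_sarr (h : IsPreBosbach s) (x y : A) : s (x ⇒ y) ≤ s (x ⇝ y) := by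
  have h₁ := h.sup_le (le_arr_sarr x y) (le_arr (x ⇝ y) y)
  have h₂ := sup_le (H := PseudoBCKAlgebra.swap H) h.swap (le_sarr_arr x y) (le_sarr (x ⇒ y) y)
  have h₃ := h.sup_eq x y
  have h₄ : s ((x ⇝ y) ⇒ y) = 1 + s y - s (x ⇝ y) :=
    sup_eq (H := PseudoBCKAlgebra.swap H) h.swap x y
  have h₅ : s ((x ⇝ y) ⇒ y) ≤ s ((x ⇒ y) ⇝ y) := h₂
  linarith

theorem arr_eq_sarr (h : IsPreBosbach s) (x y : A) : s (x ⇒ y) = s (x ⇝ y) :=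
  _root_.le_antisymm (h.arr_le_sarr x y) (arr_le_sarr (H := PseudoBCKAlgebra.swap H) h.swap x y)

theorem arr_le (h : IsPreBosbach s) (x y : A) : s (x ⇒ y) ≤ 1 - s x + s y := by
  linarith [h.sup_eq x y, h.mono (le_sarr_arr x y)]

theorem le_iterArr_arr (h : IsPreBosbach s) (x : A) (n : ℕ) (u v : A) :
    s (u ⇒ v) ≤ s (iterArr x n u ⇒ iterArr x n v) := by
  induction n with
  | zero => exact _root_.le_refl _
  | succ n ih =>
    rw [iterArr_succ, iterArr_succ]
    exact ih.trans (h.mono (arr_le_arr_arr _ _ x))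

theorem iterArr_swap (h : IsPreBosbach s) (x : A) (n : ℕ) (r : A) :
    s (iterArr x n r) = s (@iterArr A (PseudoBCKAlgebra.swap H) x n r) := by
  induction n generalizing r with
  | zero => rfl
  | succ n ih =>
    rw [iterArr_succ, h.arr_eq_sarr, sarr_iterArr, ih]
    rfl

/-- Exchange moves one batch of `n` implications onto `r`; applying `x ⇒ ·` another `n` times to
both sides adds a second. In the limit `2n` is as good as `n`. -/
theorem iterArr_add_le (h : IsPreBosbach s) (x : A) (n : ℕ) (y r : A) :
    s (iterArr x n (y ⇒ r)) + s (iterArr x n y) ≤ 1 + s (iterArr x (n + n) r) := by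
  have h₁ := h.mono (iterArr_mono x n (le_sarr_arr y r))
  rw [← sarr_iterArr, ← h.arr_eq_sarr] at h₁
  have h₂ := h.le_iterArr_arr x n (y ⇒ r) (iterArr x n r)
  rw [← iterArr_add] at h₂
  linarith [h.arr_le (iterArr x n (y ⇒ r)) (iterArr x (n + n) r)]

theorem le_iterArr_add (h : IsPreBosbach s) (x : A) (n : ℕ) {y r : A} (hr : r ≤ y) :
    1 + s (iterArr x n r) ≤ s (iterArr x n (y ⇝ r)) + s (iterArr x n y) := by
  have h₁ := h.mono (sarr_anti (le_iterArr x n y) (iterArr x n r))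
  rw [← h.arr_eq_sarr, h.arr_of_le (iterArr_mono x n hr), sarr_iterArr] at h₁
  linarith

theorem iterArr_le_of_arr_eq_one (h : IsPreBosbach s) (x : A) (n : ℕ) {u v : A}
    (huv : s (u ⇒ v) = 1) : s (iterArr x n u) ≤ s (iterArr x n v) := by
  linarith [h.le_iterArr_arr x n u v, h.arr_le (iterArr x n u) (iterArr x n v)]

/-- Unlike the inequality of values in `sup_le`, this form survives iterated implications. -/
theorem sup_arr_eq_one (h : IsPreBosbach s) {x y u : A} (hx : x ≤ u) (hy : y ≤ u) :
    s (((x ⇒ y) ⇝ y) ⇒ u) = 1 := by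
  have h₁ := h.mono (arr_anti (sarr_anti (arr_anti hx y) y) u)
  have h₂ := h.arr_of_le (le_sarr_arr u y)
  rw [h.sup_eq, h.arr_of_le hy] at h₂
  linarith [h.le_one (((x ⇒ y) ⇝ y) ⇒ u)]

/-! ### The limit state of iterated implications. -/

/-- The supremum of the values of `s` at the iterated implications `x → ⋯ → x → r`. -/
noncomputable def absorb (s : A → ℝ) (x r : A) : ℝ := ⨆ n, s (iterArr x n r)

theorem tendsto_absorb (h : IsPreBosbach s) (x r : A) :
    Tendsto (fun n => s (iterArr x n r)) atTop (𝓝 (absorb s x r)) := by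
  refine tendsto_atTop_ciSup (monotone_nat_of_le_succ fun n => ?_)
    ⟨1, by rintro _ ⟨n, rfl⟩; exact h.le_one _⟩
  rw [iterArr_succ]
  exact h.mono (le_arr _ _)

theorem absorb_swap (h : IsPreBosbach s) (x r : A) :
    @absorb A (PseudoBCKAlgebra.swap H) s x r = absorb s x r := by
  simp only [absorb, h.iterArr_swap]

theorem le_absorb (h : IsPreBosbach s) (x r : A) : s r ≤ absorb s x r :=
  ge_of_tendsto' (h.tendsto_absorb x r) fun n => h.mono (le_iterArr x n r)

theorem absorb_le_one (h : IsPreBosbach s) (x r : A) : absorb s x r ≤ 1 :=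
  le_of_tendsto' (h.tendsto_absorb x r) fun _ => h.le_one _

theorem absorb_le_of_arr_eq_one (h : IsPreBosbach s) (x : A) {u v : A}
    (huv : s (u ⇒ v) = 1) : absorb s x u ≤ absorb s x v :=
  le_of_tendsto_of_tendsto' (h.tendsto_absorb x u) (h.tendsto_absorb x v) fun n =>
    h.iterArr_le_of_arr_eq_one x n huv

theorem absorb_add_le (h : IsPreBosbach s) (x y r : A) :
    absorb s x (y ⇒ r) + absorb s x y ≤ 1 + absorb s x r := by
  have h₁ : Tendsto (fun n : ℕ => n + n) atTop atTop :=
    tendsto_atTop_mono (fun n => Nat.le_add_left n n) tendsto_id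
  exact le_of_tendsto_of_tendsto' ((h.tendsto_absorb x _).add (h.tendsto_absorb x _))
    (((h.tendsto_absorb x r).comp h₁).const_add 1) fun n => h.iterArr_add_le x n y r

theorem le_absorb_add (h : IsPreBosbach s) (x : A) {y r : A} (hr : r ≤ y) :
    1 + absorb s x r ≤ absorb s x (y ⇝ r) + absorb s x y :=
  le_of_tendsto_of_tendsto' ((h.tendsto_absorb x r).const_add 1)
    ((h.tendsto_absorb x _).add (h.tendsto_absorb x _)) fun n => h.le_iterArr_add x n hr

theorem absorb_arr_of_le (h : IsPreBosbach s) (x : A) {y r : A} (hr : r ≤ y) :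
    absorb s x (y ⇒ r) = 1 - absorb s x y + absorb s x r := by
  have h₁ := h.absorb_add_le x y r
  have h₂ := @le_absorb_add A (PseudoBCKAlgebra.swap H) s h.swap x y r hr
  simp only [h.absorb_swap] at h₂
  have h₃ : 1 + absorb s x r ≤ absorb s x (y ⇒ r) + absorb s x y := h₂
  linarith

theorem absorb_sup_le (h : IsPreBosbach s) (x y r : A) :
    absorb s x ((y ⇒ r) ⇝ r) ≤ absorb s x ((r ⇒ y) ⇝ y) :=
  h.absorb_le_of_arr_eq_one x (h.sup_arr_eq_one (le_sarr (r ⇒ y) y) (le_sarr_arr r y))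

/-- The identity expresses that the limit takes the same value on the two joins `(y ⇒ r) ⇝ r` and
`(r ⇒ y) ⇝ y`. -/
theorem absorb_add_arr (h : IsPreBosbach s) (x y r : A) :
    absorb s x y + absorb s x (y ⇒ r) = absorb s x r + absorb s x (r ⇒ y) := by
  have h₁ := h.absorb_arr_of_le x (le_sarr (y ⇒ r) r)
  have h₂ := h.absorb_arr_of_le x (le_sarr (r ⇒ y) y)
  rw [arr_sarr_arr] at h₁ h₂
  linarith [h.absorb_sup_le x y r, h.absorb_sup_le x r y]

theorem absorb_self (h : IsPreBosbach s) (x : A) : absorb s x x = 1 := by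
  refine _root_.le_antisymm (h.absorb_le_one x x)
    (ge_of_tendsto (h.tendsto_absorb x x) ((eventually_ge_atTop 1).mono fun n hn => ?_))
  obtain ⟨m, rfl⟩ := Nat.exists_eq_add_of_le' hn
  rw [iterArr_add, iterArr_succ x 0 x]
  change 1 ≤ s (iterArr x m (x ⇒ x))
  rw [arr_self, iterArr_one, h.map_one]

theorem isPreBosbach_absorb (h : IsPreBosbach s) (x : A) : IsPreBosbach (absorb s x) where
  add_arr := h.absorb_add_arr x
  add_sarr y r := by
    have := @absorb_add_arr A (PseudoBCKAlgebra.swap H) s h.swap x y r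
    simp only [h.absorb_swap] at this
    exact this
  map_one := _root_.le_antisymm (h.absorb_le_one x 1) (h.map_one ▸ h.le_absorb x 1)
  nonneg r := (h.nonneg r).trans (h.le_absorb x r)
  le_one := h.absorb_le_one x

/-- The hypothesis makes `(x ⇒ y) ⇒ y` have value 1, so no further implication by `x` raises the
value. -/
theorem absorb_of_arr_eq (h : IsPreBosbach s) {x y : A} (hxy : s (x ⇒ y) = s y) :
    absorb s x y = s y := by
  have h₁ : s ((x ⇒ y) ⇒ y) = 1 := by
    rw [h.arr_of_le (le_arr x y)]
    linarith
  refine tendsto_nhds_unique (h.tendsto_absorb x y) ?_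
  have h₂ : ∀ n, s (iterArr x n y) = s y := by
    intro n
    induction n with
    | zero => rfl
    | succ n ih =>
      refine _root_.le_antisymm ?_ (h.mono (le_iterArr x _ y))
      rw [iterArr_add]
      exact (h.iterArr_le_of_arr_eq_one x n h₁).trans ih.le
  simp only [h₂, tendsto_const_nhds]

/-- If `c` lies above `a` and `b` up to `s`-null differences, then `s c` is at least the value
at the join of `a` and `b`. -/
theorem sup_le_of_arr_eq_one (h : IsPreBosbach s) {a b c : A} (ha : s (a ⇒ c) = 1)
    (hb : s (b ⇒ c) = 1) : s ((a ⇒ b) ⇝ b) ≤ s c := by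
  -- Joining `c` with `a` and then with `b` keeps the value `s c` and produces a genuine upper bound
  -- of both.
  have h₁ := h.sup_eq a c
  have h₂ := h.sup_eq b ((a ⇒ c) ⇝ c)
  have h₃ := h.mono (arr_mono b (le_sarr (a ⇒ c) c))
  have h₄ := h.sup_le (le_trans (le_sarr_arr a c) (le_sarr (b ⇒ ((a ⇒ c) ⇝ c)) _))
    (le_sarr_arr b ((a ⇒ c) ⇝ c))
  linarith

end IsPreBosbach

/-! ### Prelinearity and extreme states. -/

section Bounded

variable {A : Type*} [BoundedPseudoBCKAlgebra A] {s : A → ℝ}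

theorem IsPreBosbach.arr_zero (h : IsPreBosbach s) (h0 : s 0 = 0) (x : A) :
    s (x ⇒ 0) = 1 - s x := by
  rw [h.arr_of_le (BoundedPseudoBCKAlgebra.zero_le x), h0, add_zero]

/-- Prelinearity up to `s`-null differences. -/
theorem IsPreBosbach.eq_one_of_arr_le (h : IsPreBosbach s) (h0 : s 0 = 0) {a b u : A}
    (hab : a ⇒ b ≤ u) (hba : b ⇒ a ≤ u) : s u = 1 := by
  have hz := @BoundedPseudoBCKAlgebra.zero_le A _
  set j := (a ⇒ b) ⇝ b with hj
  -- `(u ⇒ (j ⇒ 0)) ⇝ 0` plays the role of the product `j ⊙ u`. Modulo `s`, `a' = j ⊙ (j ⇒ a') ≤ j ⊙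
  -- u`; using this for `a` and `b` gives `s j ≤ s j + s u - 1`.
  have key : ∀ a' : A, a' ≤ j → j ⇒ a' ≤ u → s (a' ⇒ ((u ⇒ (j ⇒ 0)) ⇝ 0)) = 1 := by
    intro a' ha hu
    have h₁ := h.arr_of_le (arr_mono j (hz a'))
    rw [h.arr_of_le ha, h.arr_zero h0] at h₁
    have h₂ : a' ⇒ 0 ≤ (j ⇒ a') ⇒ (j ⇒ 0) := arr_le_arr_arr a' 0 j
    have h₃ := h.arr_of_le h₂
    rw [h.arr_zero h0, h₁] at h₃
    have h₄ := h.mono (arr_anti (arr_anti hu (j ⇒ 0)) (a' ⇒ 0))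
    rw [arr_sarr_comm, ← h.arr_eq_sarr]
    linarith [h.le_one ((u ⇒ (j ⇒ 0)) ⇒ (a' ⇒ 0))]
  have hjb : j ⇒ b ≤ u := by rw [hj, arr_sarr_arr]; exact hab
  have h₁ := h.sup_le_of_arr_eq_one (key a (le_sarr_arr a b)
    (le_trans (arr_anti (le_sarr _ b) a) hba))
    (key b (le_sarr _ b) hjb)
  rw [← h.arr_eq_sarr (u ⇒ (j ⇒ 0)) 0, h.arr_zero h0,
    h.arr_of_le (le_trans (arr_mono j (hz b)) hjb),
    h.arr_zero h0] at h₁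
  linarith [h.le_one u]

theorem IsPreBosbach.arr_arr_swap (h : IsPreBosbach s) (h0 : s 0 = 0) (a b : A) :
    s ((a ⇒ b) ⇒ (b ⇒ a)) = s (b ⇒ a) := by
  have h₁ := h.sup_eq (a ⇒ b) (b ⇒ a)
  rw [h.eq_one_of_arr_le h0 (le_sarr_arr (a ⇒ b) (b ⇒ a)) (le_sarr _ (b ⇒ a))] at h₁
  linarith

/-- The set of all real-valued Bosbach states. -/
def bosbachStates (A : Type*) [BoundedPseudoBCKAlgebra A] : Set (A → ℝ) :=
  {s | IsPreBosbach s ∧ s 0 = 0}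

theorem convex_bosbachStates : Convex ℝ (bosbachStates A) := by
  rintro s ⟨hs, hs0⟩ t ⟨ht, ht0⟩ a b ha hb hab
  refine ⟨⟨fun x y => ?_, fun x y => ?_, ?_, fun x => ?_, fun x => ?_⟩, ?_⟩ <;>
    simp only [Pi.add_apply, Pi.smul_apply, smul_eq_mul]
  · linear_combination a * hs.add_arr x y + b * ht.add_arr x y
  · linear_combination a * hs.add_sarr x y + b * ht.add_sarr x y
  · rw [hs.map_one, ht.map_one]; linarith
  · exact add_nonneg (mul_nonneg ha (hs.nonneg x)) (mul_nonneg hb (ht.nonneg x))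
  · nlinarith [hs.le_one x, ht.le_one x]
  · rw [hs0, ht0]; ring

theorem isCompact_bosbachStates : IsCompact (bosbachStates A) := by
  have e : bosbachStates A = (Set.univ.pi fun _ => Set.Icc 0 1) ∩
      ({s | ∀ x y : A, s x + s (x ⇒ y) = s y + s (y ⇒ x)} ∩
        ({s | ∀ x y : A, s x + s (x ⇝ y) = s y + s (y ⇝ x)} ∩ {s | s 1 = 1 ∧ s 0 = 0})) := by
    ext s
    constructor
    · rintro ⟨h, h0⟩
      exact ⟨fun x _ => ⟨h.nonneg x, h.le_one x⟩, h.add_arr, h.add_sarr, h.map_one, h0⟩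
    · rintro ⟨h, h₁, h₂, h₃, h0⟩
      exact ⟨⟨h₁, h₂, h₃, fun x => (h x trivial).1, fun x => (h x trivial).2⟩, h0⟩
  rw [e]
  refine (isCompact_univ_pi fun _ => isCompact_Icc).inter_right (.inter ?_ (.inter ?_ ?_))
  · simp only [Set.ofPred_forall]
    exact isClosed_iInter fun x => isClosed_iInter fun y => isClosed_eq (by fun_prop) (by fun_prop)
  · simp only [Set.ofPred_forall]
    exact isClosed_iInter fun x => isClosed_iInter fun y => isClosed_eq (by fun_prop) (by fun_prop)
  · exact (isClosed_eq (by fun_prop) continuous_const).inter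
      (isClosed_eq (by fun_prop) continuous_const)

/-- The normalization of a difference of prestates that satisfies the Bosbach identities. -/
theorem mem_bosbachStates_of_defect {g : A → ℝ} (c : ℝ) (hc : 0 < c) (hg0 : g 0 = c)
    (hg1 : g 1 = 0) (hg : ∀ x, 0 ≤ g x) (harr : ∀ x y : A, g x + g (x ⇒ y) = g y + g (y ⇒ x))
    (hsarr : ∀ x y : A, g x + g (x ⇝ y) = g y + g (y ⇝ x)) :
    (fun x => 1 - g x / c) ∈ bosbachStates A := by
  -- The identity for `x` and `0` reads `g x + g (x ⇒ 0) = c`.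
  have hle : ∀ x, g x ≤ c := fun x => by
    have := harr x 0
    rw [(le_iff_arr _ _).1 (BoundedPseudoBCKAlgebra.zero_le x), hg1, hg0] at this
    linarith [hg (x ⇒ 0)]
  refine ⟨⟨fun x y => ?_, fun x y => ?_, ?_, fun x => ?_, fun x => ?_⟩, ?_⟩
  · linear_combination -(1 / c) * harr x y
  · linear_combination -(1 / c) * hsarr x y
  · simp [hg1]
  · linarith [(div_le_one hc).2 (hle x)]
  · linarith [div_nonneg (hg x) hc.le]
  · change 1 - g 0 / c = 0
    rw [hg0, div_self hc.ne', sub_self]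

theorem exists_one_sub_absorb_eq (hs : s ∈ (bosbachStates A).extremePoints ℝ) (x : A) :
    ∃ c : ℝ, ∀ r, 1 - IsPreBosbach.absorb s x r = c * (1 - s r) := by
  obtain ⟨⟨h, h0⟩, hext⟩ := hs
  have ht := h.isPreBosbach_absorb x
  set t := IsPreBosbach.absorb s x with ht_def
  have hz := @BoundedPseudoBCKAlgebra.zero_le A _
  -- The weights will be `1 - t 0` and `t 0`, so the endpoints are separate: `t 0 = 0` forces `t =
  -- s` by negation, and `t 0 = 1` forces `t = 1`.
  rcases (ht.nonneg 0).eq_or_lt with h₁ | h₁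
  · refine ⟨1, fun r => ?_⟩
    have h₂ := ht.arr_zero h₁.symm r
    have h₃ := h.arr_zero h0 r
    linarith [h.le_absorb x r, h.le_absorb x (r ⇒ 0)]
  rcases (ht.le_one 0).eq_or_lt with h₂ | h₂
  · refine ⟨0, fun r => ?_⟩
    linarith [ht.mono (hz r), ht.le_one r]
  have m₁ : (fun r => 1 - (1 - t r) / (1 - t 0)) ∈ bosbachStates A :=
    mem_bosbachStates_of_defect (g := fun r => 1 - t r) (1 - t 0) (by linarith) rfl
      (by simp [ht.map_one]) (fun r => by linarith [ht.le_one r])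
      (fun y r => by linarith [ht.add_arr y r]) (fun y r => by linarith [ht.add_sarr y r])
  have m₂ : (fun r => 1 - (t r - s r) / t 0) ∈ bosbachStates A :=
    mem_bosbachStates_of_defect (g := fun r => t r - s r) (t 0) h₁ (by simp [h0])
      (by simp [ht.map_one, h.map_one]) (fun r => by linarith [h.le_absorb x r])
      (fun y r => by linarith [ht.add_arr y r, h.add_arr y r])
      (fun y r => by linarith [ht.add_sarr y r, h.add_sarr y r])
  have h₃ := hext m₁ m₂ ⟨1 - t 0, t 0, by linarith, h₁, by ring, by
    ext r
    have : 1 - t 0 ≠ 0 := by linarith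
    have : t 0 ≠ 0 := h₁.ne'
    simp only [Pi.add_apply, Pi.smul_apply, smul_eq_mul]
    field_simp
    ring⟩
  refine ⟨1 - t 0, fun r => ?_⟩
  have h₄ := congrFun h₃ r
  have : 1 - t 0 ≠ 0 := by linarith
  rw [← h₄]
  field_simp
  ring

theorem arr_eq_min_of_mem_extremePoints (hs : s ∈ (bosbachStates A).extremePoints ℝ) (a b : A) :
    s (a ⇒ b) = min (1 - s a + s b) 1 := by
  have h := hs.1.1
  obtain ⟨c, hc⟩ := exists_one_sub_absorb_eq hs (a ⇒ b)
  have h₁ := hc (a ⇒ b)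
  have h₂ := hc (b ⇒ a)
  rw [h.absorb_self] at h₁
  rw [h.absorb_of_arr_eq (h.arr_arr_swap hs.1.2 a b)] at h₂
  have h₃ := h.add_arr a b
  have h₄ := h.le_one (a ⇒ b)
  have h₅ := h.le_one (b ⇒ a)
  have h₆ : s (a ⇒ b) = 1 ∨ s (b ⇒ a) = 1 := by
    rcases eq_or_ne c 0 with rfl | hc0
    · right; linarith
    · left
      rw [sub_self, eq_comm, mul_eq_zero, or_iff_right hc0] at h₁
      linarith
  rcases h₆ with h₆ | h₆
  · rw [h₆, min_eq_right]; linarith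
  · rw [min_eq_left] <;> linarith

/-- Extreme Bosbach states are state-morphisms. -/
theorem exists_stateMorphism_of_mem_extremePoints (hs : s ∈ (bosbachStates A).extremePoints ℝ) :
    ∃ V : StateMorphism A, ∀ a, (V a : ℝ) = s a := by
  have h := hs.1.1
  refine ⟨⟨fun a => ⟨s a, h.nonneg a, h.le_one a⟩, ⟨Subtype.ext hs.1.2,
    arr_eq_min_of_mem_extremePoints hs, fun x y => ?_⟩⟩, fun a => rfl⟩
  rw [← arr_eq_min_of_mem_extremePoints hs, h.arr_eq_sarr]

end Bounded

end PseudoBCKAlgebra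

namespace PseudoBCKAlgebra

/-! ### Probability measures as positive functionals. -/

section Integral

variable {X : Type*} [TopologicalSpace X] [CompactSpace X]

/-- The positive normalized functionals on `C(X, ℝ)`. -/
def positiveFunctionals (X : Type*) [TopologicalSpace X] [CompactSpace X] :
    Set (WeakDual ℝ C(X, ℝ)) :=
  (WeakDual.toStrongDual ⁻¹' Metric.closedBall 0 1) ∩
    {φ | φ 1 = 1 ∧ ∀ f : C(X, ℝ), 0 ≤ f → 0 ≤ φ f}

theorem isCompact_positiveFunctionals : IsCompact (positiveFunctionals X) := by
  refine (WeakDual.isCompact_closedBall 0 1).inter_right ?_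
  refine (isClosed_eq (WeakDual.eval_continuous 1) continuous_const).inter ?_
  change IsClosed {φ : WeakDual ℝ C(X, ℝ) | ∀ f : C(X, ℝ), 0 ≤ f → 0 ≤ φ f}
  simp only [Set.ofPred_forall]
  exact isClosed_iInter fun f => isClosed_iInter fun _ =>
    isClosed_le continuous_const (WeakDual.eval_continuous f)

theorem convex_positiveFunctionals : Convex ℝ (positiveFunctionals X) := by
  refine ((convex_closedBall (0 : StrongDual ℝ C(X, ℝ)) 1).linear_preimage
    (WeakDual.toStrongDual (𝕜 := ℝ) (E := C(X, ℝ))).toLinearMap).inter ?_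
  rintro φ ⟨hφ, hφ'⟩ ψ ⟨hψ, hψ'⟩ a b ha hb hab
  refine ⟨?_, fun f hf => ?_⟩
  · change a * φ 1 + b * ψ 1 = 1
    rw [hφ, hψ, mul_one, mul_one, hab]
  · exact add_nonneg (mul_nonneg ha (hφ' f hf)) (mul_nonneg hb (hψ' f hf))

/-- Evaluation at a point, as a functional on `C(X, ℝ)`. -/
noncomputable def diracFunctional (x : X) : WeakDual ℝ C(X, ℝ) :=
  StrongDual.toWeakDual (ContinuousMap.evalCLM ℝ x)

theorem diracFunctional_mem (x : X) : diracFunctional x ∈ positiveFunctionals X := by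
  refine ⟨?_, rfl, fun f hf => hf x⟩
  refine (mem_closedBall_zero_iff (a := (ContinuousMap.evalCLM ℝ x : StrongDual ℝ C(X, ℝ)))).2 ?_
  refine ContinuousLinearMap.opNorm_le_bound _ zero_le_one fun f => ?_
  rw [one_mul]
  exact f.norm_coe_le_norm x

theorem exists_measure_of_mem_positiveFunctionals [T2Space X] [MeasurableSpace X] [BorelSpace X]
    {φ : WeakDual ℝ C(X, ℝ)} (hφ : φ ∈ positiveFunctionals X) :
    ∃ μ : Measure X, IsProbabilityMeasure μ ∧ μ.Regular ∧
      ∀ f : C(X, ℝ), φ f = ∫ x, f x ∂μ := by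
  let Λ : CompactlySupportedContinuousMap X ℝ →ₚ[ℝ] ℝ :=
    { toFun := fun g => φ g.toContinuousMap
      map_add' := fun g g' => map_add φ g.toContinuousMap g'.toContinuousMap
      map_smul' := fun c g => map_smul φ c g.toContinuousMap
      monotone' := fun g g' h => by
        have := hφ.2.2 (g'.toContinuousMap - g.toContinuousMap) fun x => sub_nonneg.2 (h x)
        rw [map_sub] at this
        exact sub_nonneg.1 this }
  have h : ∀ f : C(X, ℝ), φ f = ∫ x, f x ∂(RealRMK.rieszMeasure Λ) := fun f =>
    (RealRMK.integral_rieszMeasure Λ (CompactlySupportedContinuousMap.continuousMapEquiv f)).symm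
  refine ⟨RealRMK.rieszMeasure Λ, ⟨?_⟩, inferInstance, h⟩
  -- Real total mass 1 also excludes infinite mass, since `ENNReal.toReal` sends `∞` to 0.
  have h₁ := h 1
  rw [hφ.2.1] at h₁
  simp only [ContinuousMap.one_apply, integral_const, smul_eq_mul, mul_one] at h₁
  exact (ENNReal.toReal_eq_one_iff _).1 h₁.symm

end Integral

/-! ### Integral representation of states. -/

variable {A : Type*} [BoundedPseudoBCKAlgebra A]

/-- The evaluation of state-morphisms at `a`, as a continuous function. -/
def StateMorphism.evalMap (a : A) : C(StateMorphism A, ℝ) :=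
  ⟨fun V => V a, StateMorphism.continuous_eval a⟩

/-- Restricting functionals to evaluations has compact convex image; it contains the extreme states
via point evaluations, hence all states by Krein–Milman. -/
theorem exists_positiveFunctional_of_mem_bosbachStates {s : A → ℝ} (hs : s ∈ bosbachStates A) :
    ∃ φ ∈ positiveFunctionals (StateMorphism A), ∀ a, φ (StateMorphism.evalMap a) = s a := by
  let T : WeakDual ℝ C(StateMorphism A, ℝ) →ₗ[ℝ] (A → ℝ) :=
    { toFun := fun φ a => φ (StateMorphism.evalMap a)
      map_add' := fun _ _ => rfl
      map_smul' := fun _ _ => rfl }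
  have hT : Continuous T := continuous_pi fun a => WeakDual.eval_continuous _
  have hs' : s ∈ T '' positiveFunctionals (StateMorphism A) := by
    rw [← closure_convexHull_extremePoints isCompact_bosbachStates convex_bosbachStates] at hs
    refine closure_minimal (convexHull_min (fun t ht => ?_)
      (convex_positiveFunctionals.linear_image T))
      (isCompact_positiveFunctionals.image hT).isClosed hs
    obtain ⟨V, hV⟩ := exists_stateMorphism_of_mem_extremePoints ht
    exact ⟨diracFunctional V, diracFunctional_mem V, funext hV⟩
  obtain ⟨φ, hφ, rfl⟩ := hs'
  exact ⟨φ, hφ, fun _ => rfl⟩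

end PseudoBCKAlgebra

theorem mainTheorem10 {A : Type*} [BoundedPseudoBCKAlgebra A] (s : A → unitInterval)
    (hs : PseudoBCKAlgebra.IsBosbachState s) :
    ∃ μ : Measure (PseudoBCKAlgebra.StateMorphism A),
      IsProbabilityMeasure μ ∧ μ.Regular ∧
        ∀ a : A, (s a : ℝ) = ∫ V : PseudoBCKAlgebra.StateMorphism A, (V a : ℝ) ∂μ := by
  have h : (fun a => (s a : ℝ)) ∈ PseudoBCKAlgebra.bosbachStates A :=
    ⟨⟨hs.add_arr, hs.add_sarr, by simp [hs.map_one], fun a => (s a).2.1, fun a => (s a).2.2⟩,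
      by simp [hs.map_zero]⟩
  obtain ⟨φ, hφ, hφs⟩ := PseudoBCKAlgebra.exists_positiveFunctional_of_mem_bosbachStates h
  obtain ⟨μ, hμ, hreg, hint⟩ := PseudoBCKAlgebra.exists_measure_of_mem_positiveFunctionals hφ
  exact ⟨μ, hμ, hreg, fun a => by rw [← hφs a]; exact hint _⟩
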